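/- **Setting.** Let $d\in\mathbb N$, let $\mu$ be a Borel probability measure on $\mathbb R^d$ and $k:\mathbb R^d\times\mathbb R^d\to\mathbb R$ a symmetric positive semi-definite kernel. Write $\partial_\ell$ and $\partial_{\ell+d}$ for the partial derivatives of a function on $\mathbb R^d\times\mathbb R^d$ in the $\ell$-th coordinate of the first and of the second argument, $\nabla_1 k=(\partial_1k,\dots,\partial_dk)^\top$, and $$\operatorname{MMD}^2(\nu,\mu)=\iint k(x,y)\,\mathrm d(\nu-\mu)(x)\,\mathrm d(\nu-\mu)(y).$$ Assume: 1. for every $x$ and $\ell$ the functions $k(x,\cdot)$ and $\partial_\ell k(x,\cdot)$ are $\mu$-integrable, with $\sup_x\int k(x,y)\,\mathrm d\mu(y)<\infty$ and $\sup_x\int\partial_\ell k(x,y)\,\mathrm d\mu(y)<\infty$, and $\partial_\ell\partial_{\ell+d}k$ exists and is continuous on $\mathbb R^d\times\mathbb R^d$; 2. for all $\ell,r$ the derivative $\partial_\ell\partial_r\partial_{r+d}\partial_{\ell+d}k$ exists and is continuous on $\mathbb R^d\times\mathbb R^d$, and the maps $x\mapsto k(x,x)$, $x\mapsto\partial_\ell\partial_{\ell+d}k(x,x)$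 and $x\mapsto\partial_\ell\partial_r\partial_{r+d}\partial_{\ell+d}k(x,x)$ are continuous and bounded in absolute value by a constant $\kappa$. Given $n\ge 2$ particles $x_1^{(1)},\dots,x_n^{(1)}\in\mathbb R^d$, a step size $\gamma>0$, noise scales $\beta_t$ and independent standard Gaussian vectors $u_i^{(t)}$ in $\mathbb R^d$, noisy MMD particle descent is, for $t\ge 1$, $$x_i^{(t+1)}=x_i^{(t)}-\gamma\Big\{\frac1n\sum_{j=1}^n\nabla_1k\big(x_i^{(t)}+\beta_tu_i^{(t)},x_j^{(t)}\big)-\int\nabla_1k\big(x_i^{(t)}+\beta_tu_i^{(t)},y\big)\,\mathrm d\mu(y)\Big\}.$$ Let $\hat\nu_n^{(t)}=\frac1n\sum_{i=1}^n\delta_{x_i^{(t)}}$ and $\Phi(z,w)=\int\nabla_1k(z,y)\,\mathrm d\mu(y)-\nabla_1k(z,w)$. The noise condition at time $t$ is that, almost surely, $$\frac1n\sum_{i=1}^n\mathbb E_{u^{(t)}}\Big[\Big\|\frac1n\sum_{j=1}^n\Phi\big(x_i^{(t)}+\beta_tu_i^{(t)},x_j^{(t)}\big)\Big\|^2\Big]\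 \ge\ 4\beta_t^2d^2\kappa^2\operatorname{MMD}^2\big(\hat\nu_n^{(t)},\mu\big),$$ where the expectation is over $u^{(t)}=(u_i^{(t)})_{i=1}^n$ only, with the particles $x_i^{(t)}$ held fixed. **Statement.** For all $d$, $\kappa$, $b>0$, $A$, $B$ there is a constant $C>0$, depending only on these, such that the following holds for all $k,\mu$ as above, all $n\ge2$, all integers $T$ with $1\le T\le B(\log n)^b$, all step sizes $\gamma>0$ with $256\gamma^2d^2\kappa^2\le1$, and all initial particles with $$\operatorname{MMD}(\hat\nu_n^{(1)},\mu)\le A\,n^{-1}(\log n)^b .$$ If $\beta_t\in(0,1)$, $\gamma\beta_t=n^{-1}$ and the noise condition holds at every time $1\le t<T$, then for every $\delta>0$, with probability at least $1-e^{-\delta}$, $$\operatorname{MMD}(\hat\nu_n^{(T)},\mu)\le C\,(1+\delta)\,n^{-1}(\log n)^b .$$ In other words: if $\operatorname{MMD}(\hat\nu_n^{(1)},\mu)=O(n^{-1}(\log n)^b)$ and $T=O((\log n)^b)$, then $\operatorname{MMD}(\hat\nu_n^{(T)},\mu)=O(n^{-1}(\log n)^b)$ with high probability. -/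

import Mathlib

open MeasureTheory ProbabilityTheory Set
open scoped ENNReal

noncomputable section

namespace MMDFlow

/-- The Euclidean space `ℝᵈ`. -/
abbrev E (d : ℕ) : Type := EuclideanSpace ℝ (Fin d)

variable {d : ℕ}

/-- The `l`-th standard basis vector of `ℝᵈ`. -/
def basisVec (l : Fin d) : E d := EuclideanSpace.single l (1 : ℝ)

/-- `∂_l g (x, y)`: the partial derivative in the `l`-th coordinate of the first argument. -/
def partialFst (l : Fin d) (g : E d → E d → ℝ) (x y : E d) : ℝ :=
  lineDeriv ℝ (fun z => g z y) x (basisVec l)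

/-- `∂_{l+d} g (x, y)`: the partial derivative in the `l`-th coordinate of the second argument. -/
def partialSnd (l : Fin d) (g : E d → E d → ℝ) (x y : E d) : ℝ :=
  lineDeriv ℝ (fun z => g x z) y (basisVec l)

/-- The partial derivative `∂_l g` exists everywhere on `ℝᵈ × ℝᵈ`. -/
def HasPartialFst (l : Fin d) (g : E d → E d → ℝ) : Prop :=
  ∀ x y : E d, LineDifferentiableAt ℝ (fun z => g z y) x (basisVec l)

/-- The partial derivative `∂_{l+d} g` exists everywhere on `ℝᵈ × ℝᵈ`. -/
def HasPartialSnd (l : Fin d) (g : E d → E d → ℝ) : Prop :=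
  ∀ x y : E d, LineDifferentiableAt ℝ (fun z => g x z) y (basisVec l)

/-- `∇₁ k (x, y)`, the vector of partial derivatives in the first argument. -/
def grad₁ (k : E d → E d → ℝ) (x y : E d) : E d :=
  WithLp.toLp 2 (fun l => partialFst l k x y)

/-- Symmetric positive semi-definite kernels on `ℝᵈ`. -/
def IsKernel (k : E d → E d → ℝ) : Prop :=
  (∀ x y, k x y = k y x) ∧
    ∀ (m : ℕ) (x : Fin m → E d) (c : Fin m → ℝ), 0 ≤ ∑ i, ∑ j, c i * c j * k (x i) (x j)

/-- The standing assumption: `μ`-integrability and differentiability of the kernel. -/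
structure IntegrableDifferentiable (k : E d → E d → ℝ) (μ : Measure (E d)) : Prop where
  integrable : ∀ x, Integrable (fun y => k x y) μ
  bddAbove : BddAbove (range fun x => ∫ y, k x y ∂μ)
  integrable_partial : ∀ l x, Integrable (fun y => partialFst l k x y) μ
  bddAbove_partial : ∀ l, BddAbove (range fun x => ∫ y, partialFst l k x y ∂μ)
  hasPartialSnd : ∀ l, HasPartialSnd l k
  hasPartialFst : ∀ l, HasPartialFst l (partialSnd l k)
  continuous_mixed :
    ∀ l, Continuous fun p : E d × E d => partialFst l (partialSnd l k) p.1 p.2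

/-- Kernel regularity with constant `κ`: the fourth-order mixed derivatives
`∂_l ∂_r ∂_{r+d} ∂_{l+d} k` exist and are continuous, and `k`, `∂_l ∂_{l+d} k` and
`∂_l ∂_r ∂_{r+d} ∂_{l+d} k` are continuous and bounded by `κ` on the diagonal. -/
structure KernelRegularity (k : E d → E d → ℝ) (κ : ℝ) : Prop where
  continuous_diag : Continuous fun x => k x x
  bound : ∀ x, |k x x| ≤ κ
  continuous_diag_mixed : ∀ l, Continuous fun x => partialFst l (partialSnd l k) x x
  bound_mixed : ∀ l x, |partialFst l (partialSnd l k) x x| ≤ κ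
  hasPartial₂ : ∀ l r, HasPartialSnd r (partialSnd l k)
  hasPartial₃ : ∀ l r, HasPartialFst r (partialSnd r (partialSnd l k))
  hasPartial₄ : ∀ l r, HasPartialFst l (partialFst r (partialSnd r (partialSnd l k)))
  continuous_fourth : ∀ l r, Continuous fun p : E d × E d =>
    partialFst l (partialFst r (partialSnd r (partialSnd l k))) p.1 p.2
  bound_fourth :
    ∀ l r x, |partialFst l (partialFst r (partialSnd r (partialSnd l k))) x x| ≤ κ

/-- The maximum mean discrepancy
`MMD(ν, μ) = (∬ k(x, y) d(ν - μ)(x) d(ν - μ)(y))^{1/2}`, expanded bilinearly. -/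
def mmd (k : E d → E d → ℝ) (ν μ : Measure (E d)) : ℝ :=
  Real.sqrt ((∫ x, ∫ y, k x y ∂ν ∂ν) - (∫ x, ∫ y, k x y ∂μ ∂ν)
    - (∫ x, ∫ y, k x y ∂ν ∂μ) + ∫ x, ∫ y, k x y ∂μ ∂μ)

/-- The empirical measure `(1/n) ∑ᵢ δ_{xᵢ}`. -/
def empirical {n : ℕ} (x : Fin n → E d) : Measure (E d) :=
  (n : ℝ≥0∞)⁻¹ • ∑ i, Measure.dirac (x i)

/-- `Φ(z, w) = E_{Y ∼ μ}[∇₁ k(z, Y)] - ∇₁ k(z, w)`. -/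
def Phi (k : E d → E d → ℝ) (μ : Measure (E d)) (z w : E d) : E d :=
  (∫ y, grad₁ k z y ∂μ) - grad₁ k z w

/-- One step of noisy MMD particle descent from the particles `x`, with step size `γ`,
noise scale `β` and noise vectors `v`. -/
def descentStep {n : ℕ} (k : E d → E d → ℝ) (μ : Measure (E d)) (γ β : ℝ)
    (x v : Fin n → E d) (i : Fin n) : E d :=
  x i - γ • ((n : ℝ)⁻¹ • (∑ j, grad₁ k (x i + β • v i) (x j))
    - ∫ y, grad₁ k (x i + β • v i) y ∂μ)

/-- The law of `n` independent standard Gaussian vectors of `ℝᵈ`. -/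
def noiseLaw (d n : ℕ) : Measure (Fin n → E d) :=
  Measure.pi fun _ => stdGaussian (E d)

/-- The noise injection level condition for the noise scale `β` at the particles `x`. -/
def NoiseCondition {n : ℕ} (k : E d → E d → ℝ) (μ : Measure (E d)) (κ β : ℝ)
    (x : Fin n → E d) : Prop :=
  4 * β ^ 2 * (d : ℝ) ^ 2 * κ ^ 2 * mmd k (empirical x) μ ^ 2 ≤
    (n : ℝ)⁻¹ * ∑ i, ∫ v, ‖(n : ℝ)⁻¹ • ∑ j, Phi k μ (x i + β • v i) (x j)‖ ^ 2 ∂(noiseLaw d n)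

/-- `X t ω i` is the `i`-th particle of noisy MMD particle descent at time `t ≥ 1`, started at time
`1` from `x₁` and driven by the noise `u t i ω`. -/
structure IsNoisyDescent {n : ℕ} {Ω : Type*} (k : E d → E d → ℝ) (μ : Measure (E d)) (γ : ℝ)
    (β : ℕ → ℝ) (x₁ : Fin n → E d) (u : ℕ → Fin n → Ω → E d) (X : ℕ → Ω → Fin n → E d) :
    Prop where
  init : ∀ ω, X 1 ω = x₁
  step : ∀ t, 1 ≤ t → ∀ ω i,
    X (t + 1) ω i = descentStep k μ γ (β t) (X t ω) (fun j => u t j ω) i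

end MMDFlow

end

/-! Let `φ` be a feature map of `k` and `g` the mean of the `φ (x i)` minus `∫ φ dμ`, so that the
MMD is `‖g‖`. With `ψ l` the partial derivatives of `φ`, particle `i` moves by `γ w i`, where `w i l
= -⟪ψ l z, g⟫` and `z = x i + β u i`. Without noise, `‖g‖²` changes to first order by the average of
`-2γ ‖w i‖²`. For small `γ dκ` this term absorbs both the Taylor remainder and the squared
displacement of the features. Evaluating at `z` instead of `x i` costs at most `2γ dκ D ‖g‖²`, where
`D` bounds the ℓ¹ norm of `β u i`. Since `w` is itself linear in `g`, this error is relative to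
`‖g‖²`, so one step multiplies `‖g‖²` by at most `1 + 2γ dκ D` (`mmd_descentStep_sq_le`).

Gaussian tails give `‖u i‖ ≤ K √n` at all times outside an event of probability `e⁻ⁿ`
(`exists_noise_bound`). As `γ β = 1/n`, the factor is then `1 + O(1/√n)`. There are only `O((log
n)^b) = O(√n)` steps, so the total growth is bounded (`mmd_sq_le_of_noise_le`).

The analytic input is that `φ` is twice differentiable along coordinates with derivatives of norm at
most `√κ` (`exists_smoothFeature`). Inner products of its difference quotients are divided second
differences of `k`, and these converge because the mixed derivatives are continuous. -/

namespace MMDFlow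

open Filter Topology
open scoped RealInnerProductSpace

/-! ### The feature map of a positive semi-definite kernel -/

/-- A symmetric positive semi-definite kernel is the Gram kernel of a map into a Hilbert space. -/
theorem exists_feature_map {Y : Type} {k : Y → Y → ℝ} (hsymm : ∀ x y, k x y = k y x)
    (hpos : ∀ (m : ℕ) (x : Fin m → Y) (c : Fin m → ℝ),
      0 ≤ ∑ i, ∑ j, c i * c j * k (x i) (x j)) :
    ∃ (H : Type) (_ : NormedAddCommGroup H) (_ : InnerProductSpace ℝ H) (_ : CompleteSpace H)
      (φ : Y → H), ∀ x y, ⟪φ x, φ y⟫ = k x y := by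
  -- The scalar kernel is recast as an operator-valued one on `ℝ`; its kernel functions at the
  -- vector `1` are the features.
  let K : Matrix Y Y (ℝ →L[ℝ] ℝ) := .of fun x y => k x y • ContinuousLinearMap.id ℝ ℝ
  have hK : K.PosSemidef := by
    have htfae := (RKHS.posSemidef_tfae (K := K)).out 0 2
    refine htfae.mpr ⟨?_, fun f => ?_⟩
    · ext x y
      simp [K, Matrix.conjTranspose_apply, star_smul, ContinuousLinearMap.star_eq_adjoint,
        hsymm x y, ContinuousLinearMap.adjoint_id]
    · have h := hpos f.support.card (fun i => (f.support.equivFin.symm i : Y))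
        (fun i => f (f.support.equivFin.symm i))
      have key : ∑ i, ∑ j, f (f.support.equivFin.symm i) * f (f.support.equivFin.symm j) *
            k (f.support.equivFin.symm i) (f.support.equivFin.symm j) =
          f.sum fun x w => f.sum fun x' w' => ⟪K x' x w, w'⟫ := by
        rw [Finsupp.sum, ← Finset.sum_coe_sort f.support,
          ← Equiv.sum_comp f.support.equivFin.symm]
        refine Finset.sum_congr rfl fun i _ => ?_
        rw [Finsupp.sum, ← Finset.sum_coe_sort f.support,
          ← Equiv.sum_comp f.support.equivFin.symm]
        refine Finset.sum_congr rfl fun j _ => ?_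
        simp only [Matrix.of_apply, FunLike.coe_smul, Pi.smul_apply,
          ContinuousLinearMap.id_apply, smul_eq_mul, K, real_inner_eq_re_inner]
        simp [hsymm (f.support.equivFin.symm i : Y) (f.support.equivFin.symm j : Y)]
        ring
      rw [key] at h
      simpa using h
  have : Fact K.PosSemidef := ⟨hK⟩
  refine ⟨RKHS.OfKernel K, inferInstance, inferInstance, inferInstance,
    fun x => RKHS.kerFun (RKHS.OfKernel K) x 1, fun x y => ?_⟩
  rw [← RKHS.kernel_inner, RKHS.OfKernel.kernel_ofKernel, hsymm]
  simp [K]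

/-! ### Directional derivatives in Hilbert space -/

section Calculus

variable {V : Type*} [NormedAddCommGroup V] [NormedSpace ℝ V]
  {F : Type*} [NormedAddCommGroup F] [NormedSpace ℝ F]
  {H : Type*} [NormedAddCommGroup H] [InnerProductSpace ℝ H]

theorem hasDerivAt_comp_line {f : V → F} {f' : F} {x v : V} {t : ℝ}
    (h : HasLineDerivAt ℝ f f' (x + t • v) v) : HasDerivAt (fun s => f (x + s • v)) f' t := by
  have h1 : HasDerivAt (fun s : ℝ => f (x + t • v + s • v)) f' (t - t) := by
    simpa [HasLineDerivAt] using h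
  have h2 := h1.comp_sub_const t t
  refine h2.congr_of_eventuallyEq (Eventually.of_forall fun s => ?_)
  simp [add_assoc, ← add_smul]

/-- The mean value theorem along a line. -/
theorem exists_line_slope {f f' : V → ℝ} {v : V} (h : ∀ x, HasLineDerivAt ℝ f (f' x) x v)
    (x : V) (t : ℝ) : ∃ τ : ℝ, |τ| ≤ |t| ∧ f (x + t • v) - f x = t * f' (x + τ • v) := by
  have hd : ∀ s : ℝ, HasDerivAt (fun s => f (x + s • v)) (f' (x + s • v)) s :=
    fun s => hasDerivAt_comp_line (h _)
  have hc : Continuous fun s : ℝ => f (x + s • v) :=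
    continuous_iff_continuousAt.2 fun s => (hd s).continuousAt
  rcases lt_trichotomy t 0 with ht | rfl | ht
  · obtain ⟨τ, hτ, he⟩ := exists_hasDerivAt_eq_slope (fun s : ℝ => f (x + s • v)) _ ht
      hc.continuousOn fun s _ => hd s
    refine ⟨τ, ?_, ?_⟩
    · rw [abs_of_neg hτ.2, abs_of_neg ht]; linarith [hτ.1]
    · rw [he]; simp only [zero_smul, add_zero]; field_simp [ht.ne]; ring
  · exact ⟨0, by simp, by simp⟩
  · obtain ⟨τ, hτ, he⟩ := exists_hasDerivAt_eq_slope (fun s : ℝ => f (x + s • v)) _ ht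
      hc.continuousOn fun s _ => hd s
    refine ⟨τ, ?_, ?_⟩
    · rw [abs_of_pos hτ.1, abs_of_pos ht]; exact hτ.2.le
    · rw [he]; simp only [zero_smul, add_zero]; field_simp [ht.ne']; ring

theorem norm_line_sub_le {f : V → F} {v : V} {c : ℝ}
    (h : ∀ x, ∃ f', HasLineDerivAt ℝ f f' x v ∧ ‖f'‖ ≤ c) (x : V) (t : ℝ) :
    ‖f (x + t • v) - f x‖ ≤ c * |t| := by
  choose f' hf' hc using h
  have := Convex.norm_image_sub_le_of_norm_hasDerivWithin_le (s := univ) (x := (0 : ℝ)) (y := t)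
    (f := fun s : ℝ => f (x + s • v)) (f' := fun s => f' (x + s • v)) (C := c)
    (fun s _ => (hasDerivAt_comp_line (hf' _)).hasDerivWithinAt) (fun s _ => hc _)
    convex_univ (mem_univ _) (mem_univ _)
  simpa using this

/-- Subtracting the linear part leaves a curve with derivative at most `c * |t|` on the segment. The
mean value inequality then gives the constant `c`, not the sharp `c / 2`, which is enough here. -/
theorem norm_line_taylor_le {f f' : V → F} {v : V} {c : ℝ}
    (h : ∀ x, HasLineDerivAt ℝ f (f' x) x v) (hc : 0 ≤ c)
    (h' : ∀ x (t : ℝ), ‖f' (x + t • v) - f' x‖ ≤ c * |t|) (x : V) (t : ℝ) :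
    ‖f (x + t • v) - f x - t • f' x‖ ≤ c * t ^ 2 := by
  have := Convex.norm_image_sub_le_of_norm_hasDerivWithin_le (s := uIcc 0 t) (x := (0 : ℝ))
    (y := t) (f := fun s : ℝ => f (x + s • v) - s • f' x)
    (f' := fun s => f' (x + s • v) - f' x) (C := c * |t|)
    (fun s _ => by
      have h1 := (hasDerivAt_comp_line (h (x + s • v))).fun_sub
        ((hasDerivAt_id s).smul_const (f' x))
      simpa using h1.hasDerivWithinAt)
    (fun s hs => (h' x s).trans
      (mul_le_mul_of_nonneg_left (by simpa using abs_sub_left_of_mem_uIcc hs) hc))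
    (convex_uIcc 0 t) left_mem_uIcc right_mem_uIcc
  have e : c * |t| * ‖t - 0‖ = c * t ^ 2 := by
    rw [sub_zero, Real.norm_eq_abs, mul_assoc, abs_mul_abs_self, sq]
  rw [e] at this
  convert this using 2
  simp only [zero_smul, add_zero, sub_zero]
  abel

/-- A curve in Hilbert space is differentiable as soon as the inner products of its difference
quotients converge. -/
theorem exists_hasLineDerivAt_of_tendsto [CompleteSpace H] {ψ : V → H} {x v : V} {c : ℝ}
    (h : Tendsto (fun p : ℝ × ℝ => ⟪p.1⁻¹ • (ψ (x + p.1 • v) - ψ x),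
        p.2⁻¹ • (ψ (x + p.2 • v) - ψ x)⟫) (𝓝[≠] 0 ×ˢ 𝓝[≠] 0) (𝓝 c)) :
    ∃ χ, HasLineDerivAt ℝ ψ χ x v ∧ ‖χ‖ ^ 2 = c := by
  set D : ℝ → H := fun t => t⁻¹ • (ψ (x + t • v) - ψ x)
  change Tendsto (fun p : ℝ × ℝ => ⟪D p.1, D p.2⟫) _ _ at h
  -- The square `‖D t - D s‖²` expands into three inner products with the same limit `c`, so it
  -- tends to `c - 2c + c = 0` and the quotients are Cauchy.
  have h1 : Tendsto (fun p : ℝ × ℝ => ⟪D p.1, D p.1⟫) (𝓝[≠] 0 ×ˢ 𝓝[≠] 0) (𝓝 c) :=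
    h.comp (tendsto_fst.prodMk tendsto_fst)
  have h2 : Tendsto (fun p : ℝ × ℝ => ⟪D p.2, D p.2⟫) (𝓝[≠] 0 ×ˢ 𝓝[≠] 0) (𝓝 c) :=
    h.comp (tendsto_snd.prodMk tendsto_snd)
  have h3 : Tendsto (fun p : ℝ × ℝ => dist (D p.1) (D p.2)) (𝓝[≠] 0 ×ˢ 𝓝[≠] 0) (𝓝 0) := by
    have := (((h1.sub (h.const_mul 2)).add h2).sqrt)
    rw [show c - 2 * c + c = 0 by ring, Real.sqrt_zero] at this
    refine this.congr fun p => ?_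
    rw [dist_eq_norm, ← Real.sqrt_sq (norm_nonneg (D p.1 - D p.2)), norm_sub_sq_real,
      real_inner_self_eq_norm_sq, real_inner_self_eq_norm_sq]
  have hcauchy : Cauchy (map D (𝓝[≠] 0)) :=
    cauchy_map_iff.2 ⟨inferInstance, tendsto_uniformity_iff_dist_tendsto_zero.2 h3⟩
  obtain ⟨χ, hχ⟩ := cauchy_map_iff_exists_tendsto.1 hcauchy
  refine ⟨χ, ?_, ?_⟩
  · rw [HasLineDerivAt, hasDerivAt_iff_tendsto_slope_zero]
    simpa [D] using hχ
  · have h4 : Tendsto (fun t => ⟪D t, D t⟫) (𝓝[≠] 0) (𝓝 c) :=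
      h.comp (tendsto_id.prodMk tendsto_id)
    have h5 := tendsto_nhds_unique h4 (hχ.inner hχ)
    rw [h5, real_inner_self_eq_norm_sq]

/-- If the second differences of the Gram kernel of `ψ` are controlled near the diagonal point
`(x, x)`, then `ψ` is differentiable at `x`. -/
theorem exists_hasLineDerivAt_of_second_difference [CompleteSpace H] {ψ : V → H} {x v : V} {c : ℝ}
    (h : ∀ ε > 0, ∃ δ > 0, ∀ t s : ℝ, |t| < δ → |s| < δ →
      |⟪ψ (x + t • v) - ψ x, ψ (x + s • v) - ψ x⟫ - t * s * c| ≤ ε * |t * s|) :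
    ∃ χ, HasLineDerivAt ℝ ψ χ x v ∧ ‖χ‖ ^ 2 = c := by
  refine exists_hasLineDerivAt_of_tendsto (Metric.tendsto_nhds.2 fun ε hε => ?_)
  obtain ⟨δ, hδ, H'⟩ := h (ε / 2) (half_pos hε)
  have hev : ∀ᶠ t : ℝ in 𝓝[≠] 0, t ≠ 0 ∧ |t| < δ := by
    refine eventually_mem_nhdsWithin.and (nhdsWithin_le_nhds ?_)
    filter_upwards [Metric.ball_mem_nhds (0 : ℝ) hδ] with t ht
    simpa using ht
  filter_upwards [hev.prod_mk hev] with p hp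
  obtain ⟨⟨ht, ht'⟩, hs, hs'⟩ := hp
  have := H' p.1 p.2 ht' hs'
  have hts : 0 < |p.1 * p.2| := abs_pos.2 (mul_ne_zero ht hs)
  rw [Real.dist_eq, inner_smul_left, inner_smul_right]
  simp only [conj_trivial]
  set w := ⟪ψ (x + p.1 • v) - ψ x, ψ (x + p.2 • v) - ψ x⟫
  have e : p.1⁻¹ * (p.2⁻¹ * w) - c = (w - p.1 * p.2 * c) / (p.1 * p.2) := by
    field_simp
  rw [e, abs_div]
  calc _ ≤ ε / 2 := (div_le_iff₀ hts).2 this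
    _ < ε := half_lt_self hε

end Calculus

/-! ### Second differences of the kernel and differentiability of feature maps -/

section SecondDifference

variable {V : Type*} [NormedAddCommGroup V] [NormedSpace ℝ V]
  {H : Type*} [NormedAddCommGroup H] [InnerProductSpace ℝ H]

/-- The mean value theorem is applied in the second argument to a difference taken in the first,
then in the first argument. Only the derivatives in this order have to exist. -/
theorem exists_second_difference_eq {k p q : V → V → ℝ} {v : V}
    (hp : ∀ x y, HasLineDerivAt ℝ (fun z => k x z) (p x y) y v)
    (hq : ∀ x y, HasLineDerivAt ℝ (fun z => p z y) (q x y) x v) (x : V) (t s : ℝ) :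
    ∃ τ σ : ℝ, |τ| ≤ |t| ∧ |σ| ≤ |s| ∧
      (k (x + t • v) (x + s • v) - k x (x + s • v)) - (k (x + t • v) x - k x x)
        = t * s * q (x + τ • v) (x + σ • v) := by
  have h1 : ∀ y, HasLineDerivAt ℝ (fun z => k (x + t • v) z - k x z)
      (p (x + t • v) y - p x y) y v := fun y => by
    have := HasDerivAt.fun_sub (hp (x + t • v) y) (hp x y)
    exact this
  obtain ⟨σ, hσ, e1⟩ := exists_line_slope h1 x s
  obtain ⟨τ, hτ, e2⟩ := exists_line_slope (fun z => hq z (x + σ • v)) x t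
  refine ⟨τ, σ, hτ, hσ, ?_⟩
  rw [e1, e2]
  ring

/-- Three mean value steps, in the order in which the derivatives are given: `v` in the second
argument, `v` in the first, `e` in the first. -/
theorem exists_third_difference_eq {p p₂ p₃ p₄ : V → V → ℝ} {v e : V}
    (h₂ : ∀ x y, HasLineDerivAt ℝ (fun z => p x z) (p₂ x y) y v)
    (h₃ : ∀ x y, HasLineDerivAt ℝ (fun z => p₂ z y) (p₃ x y) x v)
    (h₄ : ∀ x y, HasLineDerivAt ℝ (fun z => p₃ z y) (p₄ x y) x e) (x : V) (t s h : ℝ) :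
    ∃ τ σ η : ℝ, |τ| ≤ |t| ∧ |σ| ≤ |s| ∧ |η| ≤ |h| ∧
      ((p (x + t • v + h • e) (x + s • v) - p (x + t • v) (x + s • v))
          - (p (x + h • e) (x + s • v) - p x (x + s • v)))
        - ((p (x + t • v + h • e) x - p (x + t • v) x) - (p (x + h • e) x - p x x))
        = h * (t * s * p₄ (x + τ • v + η • e) (x + σ • v)) := by
  have h1 : ∀ y, HasLineDerivAt ℝ
      (fun z => (p (x + t • v + h • e) z - p (x + t • v) z) - (p (x + h • e) z - p x z))
      ((p₂ (x + t • v + h • e) y - p₂ (x + t • v) y) - (p₂ (x + h • e) y - p₂ x y)) y v :=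
    fun y => HasDerivAt.fun_sub (HasDerivAt.fun_sub (h₂ _ y) (h₂ _ y))
      (HasDerivAt.fun_sub (h₂ _ y) (h₂ _ y))
  obtain ⟨σ, hσ, e1⟩ := exists_line_slope h1 x s
  have h2 : ∀ z, HasLineDerivAt ℝ (fun z => p₂ (z + h • e) (x + σ • v) - p₂ z (x + σ • v))
      (p₃ (z + h • e) (x + σ • v) - p₃ z (x + σ • v)) z v := fun z => by
    have h3 := h₃ (z + h • e) (x + σ • v)
    have := HasDerivAt.fun_sub h3 (h₃ z (x + σ • v))
    refine HasDerivAt.congr_of_eventuallyEq this (Eventually.of_forall fun r => ?_)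
    simp [add_right_comm]
  obtain ⟨τ, hτ, e2⟩ := exists_line_slope h2 x t
  obtain ⟨η, hη, e3⟩ := exists_line_slope (fun z => h₄ z (x + σ • v)) (x + τ • v) h
  refine ⟨τ, σ, η, hτ, hσ, hη, ?_⟩
  rw [e1, e2, e3]
  ring

theorem exists_near_diagonal {W : Type*} [NormedAddCommGroup W] {q : W → W → ℝ} (hq : Continuous fun z : W × W => q z.1 z.2) (x : W)
    {ε : ℝ} (hε : 0 < ε) :
    ∃ δ > 0, ∀ a b : W, ‖a‖ < δ → ‖b‖ < δ → |q (x + a) (x + b) - q x x| ≤ ε := by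
  obtain ⟨δ, hδ, h⟩ := Metric.continuous_iff.1 hq (x, x) ε hε
  refine ⟨δ, hδ, fun a b ha hb => ?_⟩
  have := h (x + a, x + b) (by simp [dist_eq_norm, ha, hb])
  exact le_of_lt (by simpa [Real.dist_eq] using this)

/-- The feature map of a kernel with continuous mixed derivative `q` in direction `v` is
differentiable in direction `v`. -/
theorem exists_hasLineDerivAt_feature [CompleteSpace H] {φ : V → H} {p q : V → V → ℝ} {v : V}
    (hv : ‖v‖ = 1)
    (hp : ∀ x y, HasLineDerivAt ℝ (fun z => ⟪φ x, φ z⟫) (p x y) y v)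
    (hq : ∀ x y, HasLineDerivAt ℝ (fun z => p z y) (q x y) x v)
    (hqc : Continuous fun z : V × V => q z.1 z.2) (x : V) :
    ∃ χ, HasLineDerivAt ℝ φ χ x v ∧ ‖χ‖ ^ 2 = q x x := by
  refine exists_hasLineDerivAt_of_second_difference fun ε hε => ?_
  obtain ⟨δ, hδ, H'⟩ := exists_near_diagonal hqc x hε
  refine ⟨δ, hδ, fun t s ht hs => ?_⟩
  obtain ⟨τ, σ, hτ, hσ, e⟩ := exists_second_difference_eq hp hq x t s
  have e' : ⟪φ (x + t • v) - φ x, φ (x + s • v) - φ x⟫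
      = t * s * q (x + τ • v) (x + σ • v) := by
    rw [← e]; simp only [inner_sub_left, inner_sub_right]
  rw [e', ← mul_sub, abs_mul, mul_comm]
  refine mul_le_mul_of_nonneg_right (H' _ _ ?_ ?_) (abs_nonneg _)
  · simpa [norm_smul, hv] using hτ.trans_lt ht
  · simpa [norm_smul, hv] using hσ.trans_lt hs

/-- Differentiability of the derivative `ψ` (in direction `e`) of a feature map `φ`, from the
fourth-order mixed derivative of the kernel. -/
theorem exists_hasLineDerivAt_deriv_feature [CompleteSpace H] {φ ψ : V → H}
    {p₂ p₃ p₄ : V → V → ℝ} {v e : V} (hv : ‖v‖ = 1) (he : ‖e‖ = 1)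
    (hψ : ∀ x, HasLineDerivAt ℝ φ (ψ x) x e)
    (h₂ : ∀ x y, HasLineDerivAt ℝ (fun z => ⟪φ x, ψ z⟫) (p₂ x y) y v)
    (h₃ : ∀ x y, HasLineDerivAt ℝ (fun z => p₂ z y) (p₃ x y) x v)
    (h₄ : ∀ x y, HasLineDerivAt ℝ (fun z => p₃ z y) (p₄ x y) x e)
    (hc : Continuous fun z : V × V => p₄ z.1 z.2) (x : V) :
    ∃ χ, HasLineDerivAt ℝ ψ χ x v ∧ ‖χ‖ ^ 2 = p₄ x x := by
  refine exists_hasLineDerivAt_of_second_difference fun ε hε => ?_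
  obtain ⟨δ, hδ, H'⟩ := exists_near_diagonal hc x hε
  -- The first argument is displaced along both `v` and `e`, each by less than `δ / 2`.
  refine ⟨δ / 2, half_pos hδ, fun t s ht hs => ?_⟩
  have hquot : ∀ a, Tendsto (fun h : ℝ => h⁻¹ • (φ (a + h • e) - φ a)) (𝓝[≠] 0) (𝓝 (ψ a)) :=
    fun a => by simpa using hasDerivAt_iff_tendsto_slope_zero.1 (hψ a)
  -- Only the left factor `ψ` is replaced by difference quotients of `φ`; the bound is uniform in
  -- `h` and passes to the limit.
  have hlim : Tendsto (fun h : ℝ => |⟪h⁻¹ • (φ (x + t • v + h • e) - φ (x + t • v))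
      - h⁻¹ • (φ (x + h • e) - φ x), ψ (x + s • v) - ψ x⟫ - t * s * p₄ x x|) (𝓝[≠] 0)
      (𝓝 |⟪ψ (x + t • v) - ψ x, ψ (x + s • v) - ψ x⟫ - t * s * p₄ x x|) :=
    (((((hquot _).sub (hquot x)).inner tendsto_const_nhds)).sub_const _).abs
  refine le_of_tendsto hlim ?_
  have hev : ∀ᶠ h : ℝ in 𝓝[≠] 0, h ≠ 0 ∧ |h| < δ / 2 := by
    refine eventually_mem_nhdsWithin.and (nhdsWithin_le_nhds ?_)
    filter_upwards [Metric.ball_mem_nhds (0 : ℝ) (half_pos hδ)] with t ht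
    simpa using ht
  filter_upwards [hev] with h hh
  obtain ⟨τ, σ, η, hτ, hσ, hη, eq⟩ := exists_third_difference_eq h₂ h₃ h₄ x t s h
  have e' : ⟪h⁻¹ • (φ (x + t • v + h • e) - φ (x + t • v))
      - h⁻¹ • (φ (x + h • e) - φ x), ψ (x + s • v) - ψ x⟫
      = t * s * p₄ (x + τ • v + η • e) (x + σ • v) := by
    rw [← smul_sub, inner_smul_left, conj_trivial, inv_mul_eq_iff_eq_mul₀ hh.1, ← eq]
    simp only [inner_sub_left, inner_sub_right]
  rw [e', ← mul_sub, abs_mul, mul_comm, add_assoc]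
  refine mul_le_mul_of_nonneg_right (H' _ _ ?_ ?_) (abs_nonneg _)
  · calc ‖τ • v + η • e‖ ≤ ‖τ • v‖ + ‖η • e‖ := norm_add_le _ _
      _ = |τ| + |η| := by simp [norm_smul, hv, he]
      _ < δ := by linarith [hh.2]
  · have : ‖σ • v‖ = |σ| := by simp [norm_smul, hv]
    linarith

end SecondDifference

/-- `φ` is a feature map of `k` with partial derivatives `ψ l`, all of norm at most `c`, and such
that the second partial derivatives exist and have norm at most `c`. -/
structure IsSmoothFeature {d : ℕ} {H : Type*} [NormedAddCommGroup H] [InnerProductSpace ℝ H]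
    (k : E d → E d → ℝ) (c : ℝ) (φ : E d → H) (ψ : Fin d → E d → H) : Prop where
  inner_eq : ∀ x y, ⟪φ x, φ y⟫ = k x y
  norm_le : ∀ x, ‖φ x‖ ≤ c
  hasLineDerivAt : ∀ l x, HasLineDerivAt ℝ φ (ψ l x) x (basisVec l)
  norm_deriv_le : ∀ l x, ‖ψ l x‖ ≤ c
  exists_second_deriv : ∀ l r x, ∃ χ, HasLineDerivAt ℝ (ψ l) χ x (basisVec r) ∧ ‖χ‖ ≤ c

theorem norm_basisVec {d : ℕ} (l : Fin d) : ‖basisVec l‖ = 1 := by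
  simp [basisVec]

/-- The squared norms of the derivatives of `φ` are mixed derivatives of `k` on the diagonal, hence
at most `κ`. The identity `∂_{l+d} k (x, y) = ⟪φ x, ψ l y⟫` turns the fourth-order hypotheses into
differentiability of `ψ l`. -/
theorem exists_smoothFeature {d : ℕ} {k : E d → E d → ℝ} {μ : Measure (E d)} {κ : ℝ}
    (hk : IsKernel k) (h1 : IntegrableDifferentiable k μ) (h2 : KernelRegularity k κ) :
    ∃ (H : Type) (_ : NormedAddCommGroup H) (_ : InnerProductSpace ℝ H) (_ : CompleteSpace H)
      (φ : E d → H) (ψ : Fin d → E d → H), IsSmoothFeature k (√κ) φ ψ := by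
  obtain ⟨H, i1, i2, i3, φ, hφ⟩ := exists_feature_map hk.1 hk.2
  have hsq : ∀ {a : H} {r : ℝ}, ‖a‖ ^ 2 = r → |r| ≤ κ → ‖a‖ ≤ √κ := fun ha hr =>
    Real.le_sqrt_of_sq_le (ha.le.trans ((le_abs_self _).trans hr))
  have hD : ∀ l x, ∃ χ, HasLineDerivAt ℝ φ χ x (basisVec l) ∧
      ‖χ‖ ^ 2 = partialFst l (partialSnd l k) x x := fun l x =>
    exists_hasLineDerivAt_feature (p := partialSnd l k) (norm_basisVec l)
      (fun x y => by simp only [hφ]; exact (h1.hasPartialSnd l x y).hasLineDerivAt)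
      (fun x y => (h1.hasPartialFst l x y).hasLineDerivAt) (h1.continuous_mixed l) x
  choose ψ hψ hψn using hD
  have hp : ∀ l x y, partialSnd l k x y = ⟪φ x, ψ l y⟫ := fun l x y => by
    have e1 : HasDerivAt (fun t : ℝ => ⟪φ x, φ (y + t • basisVec l)⟫) ⟪φ x, ψ l y⟫ 0 := by
      simpa using (hasDerivAt_const (0 : ℝ) (φ x)).inner ℝ (hψ l y)
    simp only [hφ] at e1
    exact HasLineDerivAt.lineDeriv e1
  refine ⟨H, i1, i2, i3, φ, ψ, hφ, fun x => ?_, hψ, fun l x => ?_, fun l r x => ?_⟩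
  · exact hsq (by rw [← hφ, real_inner_self_eq_norm_sq]) (h2.bound x)
  · exact hsq (hψn l x) (h2.bound_mixed l x)
  · obtain ⟨χ, hχ, hn⟩ := exists_hasLineDerivAt_deriv_feature (φ := φ) (ψ := ψ l)
      (p₂ := partialSnd r (partialSnd l k)) (norm_basisVec r) (norm_basisVec l) (hψ l)
      (fun x y => by simp only [← hp]; exact (h2.hasPartial₂ l r x y).hasLineDerivAt)
      (fun x y => (h2.hasPartial₃ l r x y).hasLineDerivAt)
      (fun x y => (h2.hasPartial₄ l r x y).hasLineDerivAt) (h2.continuous_fourth l r) x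
    exact ⟨χ, hχ, hsq hn (h2.bound_fourth l r x)⟩

/-! ### From coordinate lines to arbitrary displacements -/

section Coordinates

variable {d : ℕ} {F : Type*} [NormedAddCommGroup F] [NormedSpace ℝ F]

theorem sum_smul_basisVec (w : E d) : ∑ l, w l • basisVec l = w := by
  ext j
  simp [basisVec, Finset.sum_apply, Pi.single_apply]

/-- Only control along coordinate lines is assumed, so the displacement is made one coordinate at a
time; this is why the ℓ¹ norm appears. -/
theorem norm_add_sum_sub_le {G : Type*} [NormedAddCommGroup G] {g : E d → G} {c : ℝ}
    (h : ∀ l x (t : ℝ), ‖g (x + t • basisVec l) - g x‖ ≤ c * |t|) (x : E d) (w : Fin d → ℝ)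
    (S : Finset (Fin d)) : ‖g (x + ∑ l ∈ S, w l • basisVec l) - g x‖ ≤ c * ∑ l ∈ S, |w l| := by
  induction S using Finset.induction_on with
  | empty => simp
  | insert a S ha ih =>
    rw [Finset.sum_insert ha, Finset.sum_insert ha, add_comm (w a • _), ← add_assoc]
    set y := x + ∑ l ∈ S, w l • basisVec l
    calc ‖g (y + w a • basisVec a) - g x‖
        ≤ ‖g (y + w a • basisVec a) - g y‖ + ‖g y - g x‖ := norm_sub_le_norm_sub_add_norm_sub _ _ _
      _ ≤ c * |w a| + c * ∑ l ∈ S, |w l| := add_le_add (h _ _ _) ih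
      _ = _ := by ring

/-- When coordinate `a` is added, moving the base point of `g' a` back to `x` costs `c * |w a| * A`,
and `w a ^ 2 + |w a| * A + A ^ 2 ≤ (|w a| + A) ^ 2`. -/
theorem norm_add_sum_taylor_le {g : E d → F} {g' : Fin d → E d → F} {c : ℝ} (hc : 0 ≤ c)
    (h : ∀ l x (t : ℝ), ‖g (x + t • basisVec l) - g x - t • g' l x‖ ≤ c * t ^ 2)
    (h' : ∀ r l x (t : ℝ), ‖g' r (x + t • basisVec l) - g' r x‖ ≤ c * |t|)
    (x : E d) (w : Fin d → ℝ) (S : Finset (Fin d)) :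
    ‖g (x + ∑ l ∈ S, w l • basisVec l) - g x - ∑ l ∈ S, w l • g' l x‖
      ≤ c * (∑ l ∈ S, |w l|) ^ 2 := by
  induction S using Finset.induction_on with
  | empty => simp
  | insert a S ha ih =>
    rw [Finset.sum_insert ha, Finset.sum_insert ha, Finset.sum_insert ha, add_comm (w a • _),
      ← add_assoc]
    have hL := norm_add_sum_sub_le (h' a) x w S
    set y := x + ∑ l ∈ S, w l • basisVec l
    set A := ∑ l ∈ S, |w l|
    have hA : 0 ≤ A := Finset.sum_nonneg fun _ _ => abs_nonneg _
    have e : g (y + w a • basisVec a) - g x - (w a • g' a x + ∑ l ∈ S, w l • g' l x)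
        = (g (y + w a • basisVec a) - g y - w a • g' a y) + w a • (g' a y - g' a x)
          + (g y - g x - ∑ l ∈ S, w l • g' l x) := by
      rw [smul_sub]; abel
    rw [e]
    calc _ ≤ c * w a ^ 2 + |w a| * (c * A) + c * A ^ 2 := by
          refine norm_add₃_le.trans (add_le_add_three (h _ _ _) ?_ ih)
          rw [norm_smul, Real.norm_eq_abs]
          exact mul_le_mul_of_nonneg_left hL (abs_nonneg _)
      _ ≤ c * (|w a| + A) ^ 2 := by
          rw [← sq_abs (w a)]
          nlinarith [mul_nonneg hc (mul_nonneg (abs_nonneg (w a)) hA)]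

theorem sq_sum_abs_le (w : Fin d → ℝ) : (∑ l, |w l|) ^ 2 ≤ d * ∑ l, w l ^ 2 := by
  simpa using sq_sum_le_card_mul_sum_sq (s := Finset.univ) (f := fun l => |w l|)

theorem sum_abs_le_sqrt_mul_norm (w : E d) : ∑ l, |w l| ≤ √d * ‖w‖ := by
  rw [EuclideanSpace.norm_eq, ← Real.sqrt_mul (by positivity)]
  exact Real.le_sqrt_of_sq_le (by simpa using sq_sum_abs_le w.ofLp)

end Coordinates

/-! ### Lipschitz and Taylor bounds for the feature map; mean embeddings -/

namespace IsSmoothFeature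

variable {d : ℕ} {H : Type*} [NormedAddCommGroup H] [InnerProductSpace ℝ H]
  {k : E d → E d → ℝ} {c : ℝ} {φ : E d → H} {ψ : Fin d → E d → H}

theorem partialFst_eq (hφ : IsSmoothFeature k c φ ψ) (l : Fin d) (x y : E d) :
    partialFst l k x y = ⟪ψ l x, φ y⟫ := by
  have e1 : HasDerivAt (fun t : ℝ => ⟪φ (x + t • basisVec l), φ y⟫) ⟪ψ l x, φ y⟫ 0 := by
    simpa using HasDerivAt.inner ℝ (hφ.hasLineDerivAt l x) (hasDerivAt_const (0 : ℝ) (φ y))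
  simp only [hφ.inner_eq] at e1
  exact HasLineDerivAt.lineDeriv e1

theorem nonneg (hφ : IsSmoothFeature k c φ ψ) : 0 ≤ c := (norm_nonneg _).trans (hφ.norm_le 0)

theorem norm_sub_le (hφ : IsSmoothFeature k c φ ψ) (x w : E d) :
    ‖φ (x + w) - φ x‖ ≤ c * ∑ l, |w l| := by
  have := norm_add_sum_sub_le (g := φ) (c := c) (fun l => norm_line_sub_le fun x =>
    ⟨_, hφ.hasLineDerivAt l x, hφ.norm_deriv_le l x⟩) x w Finset.univ
  rwa [sum_smul_basisVec] at this

theorem norm_deriv_sub_le (hφ : IsSmoothFeature k c φ ψ) (l : Fin d) (x w : E d) :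
    ‖ψ l (x + w) - ψ l x‖ ≤ c * ∑ r, |w r| := by
  have := norm_add_sum_sub_le (g := ψ l) (c := c) (fun r => norm_line_sub_le
    (hφ.exists_second_deriv l r)) x w Finset.univ
  rwa [sum_smul_basisVec] at this

theorem norm_taylor_le (hφ : IsSmoothFeature k c φ ψ) (x w : E d) :
    ‖φ (x + w) - φ x - ∑ l, w l • ψ l x‖ ≤ c * (∑ l, |w l|) ^ 2 := by
  have := norm_add_sum_taylor_le (g := φ) (g' := ψ) hφ.nonneg
    (fun l => norm_line_taylor_le (hφ.hasLineDerivAt l) hφ.nonneg fun x t =>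
      norm_line_sub_le (hφ.exists_second_deriv l l) x t)
    (fun r l => norm_line_sub_le (hφ.exists_second_deriv r l)) x w Finset.univ
  rwa [sum_smul_basisVec] at this

theorem continuous (hφ : IsSmoothFeature k c φ ψ) : Continuous φ := by
  have h : LipschitzWith (Real.toNNReal (c * √d)) φ := by
    refine LipschitzWith.of_dist_le_mul fun x y => ?_
    have h1 := hφ.norm_sub_le y (x - y)
    rw [add_sub_cancel] at h1
    rw [dist_eq_norm, dist_eq_norm, Real.coe_toNNReal _ (mul_nonneg hφ.nonneg (Real.sqrt_nonneg _)),
      mul_assoc]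
    exact h1.trans (mul_le_mul_of_nonneg_left (sum_abs_le_sqrt_mul_norm _) hφ.nonneg)
  exact h.continuous

theorem integrable (hφ : IsSmoothFeature k c φ ψ) (ν : Measure (E d)) [IsFiniteMeasure ν] :
    Integrable φ ν :=
  .of_bound hφ.continuous.aestronglyMeasurable c (Eventually.of_forall hφ.norm_le)

theorem integral_kernel [CompleteSpace H] (hφ : IsSmoothFeature k c φ ψ) (ν : Measure (E d))
    [IsFiniteMeasure ν] (x : E d) : ∫ y, k x y ∂ν = ⟪φ x, ∫ y, φ y ∂ν⟫ := by
  simp only [← hφ.inner_eq]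
  exact integral_inner (hφ.integrable ν) _

theorem integral_integral_kernel [CompleteSpace H] (hφ : IsSmoothFeature k c φ ψ)
    (ν ρ : Measure (E d)) [IsFiniteMeasure ν] [IsFiniteMeasure ρ] :
    ∫ x, ∫ y, k x y ∂ν ∂ρ = ⟪∫ x, φ x ∂ρ, ∫ y, φ y ∂ν⟫ := by
  simp only [hφ.integral_kernel ν, real_inner_comm (∫ y, φ y ∂ν)]
  exact integral_inner (hφ.integrable ρ) _

/-- The four double integrals are inner products of mean embeddings, so the root is taken of an
expanded square. -/
theorem mmd_eq [CompleteSpace H] (hφ : IsSmoothFeature k c φ ψ) (ν μ : Measure (E d))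
    [IsFiniteMeasure ν] [IsFiniteMeasure μ] :
    mmd k ν μ = ‖∫ x, φ x ∂ν - ∫ x, φ x ∂μ‖ := by
  rw [mmd, hφ.integral_integral_kernel, hφ.integral_integral_kernel,
    hφ.integral_integral_kernel, hφ.integral_integral_kernel,
    ← Real.sqrt_sq (norm_nonneg (∫ x, φ x ∂ν - ∫ x, φ x ∂μ)), norm_sub_sq_real,
    real_inner_comm (∫ x, φ x ∂μ), real_inner_self_eq_norm_sq, real_inner_self_eq_norm_sq]
  congr 1
  ring

end IsSmoothFeature

/-! ### Empirical measures and the descent in feature space -/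

theorem isProbabilityMeasure_empirical {d n : ℕ} (hn : n ≠ 0) (x : Fin n → E d) :
    IsProbabilityMeasure (empirical x) := by
  constructor
  simp [empirical, ENNReal.inv_mul_cancel, hn]

theorem integral_empirical {d n : ℕ} {F : Type*} [NormedAddCommGroup F] [NormedSpace ℝ F]
    [CompleteSpace F] (x : Fin n → E d) (f : E d → F) :
    ∫ y, f y ∂(empirical x) = (n : ℝ)⁻¹ • ∑ i, f (x i) := by
  rw [empirical, integral_smul_measure, integral_finsetSum_measure]
  · simp
  · exact fun i _ => integrable_dirac (by simp)

namespace IsSmoothFeature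

variable {d : ℕ} {H : Type*} [NormedAddCommGroup H] [InnerProductSpace ℝ H] [CompleteSpace H]
  {k : E d → E d → ℝ} {c : ℝ} {φ : E d → H} {ψ : Fin d → E d → H}

theorem mmd_empirical (hφ : IsSmoothFeature k c φ ψ) (μ : Measure (E d))
    [IsFiniteMeasure μ] {n : ℕ} (hn : n ≠ 0) (x : Fin n → E d) :
    mmd k (empirical x) μ = ‖(n : ℝ)⁻¹ • ∑ i, φ (x i) - ∫ y, φ y ∂μ‖ := by
  have := isProbabilityMeasure_empirical hn x
  rw [hφ.mmd_eq, integral_empirical]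

/-- Both mean embeddings lie in the ball of radius `c`. The bound controls the Taylor remainder in
one step and settles the case of large `δ`. -/
theorem mmd_le (hφ : IsSmoothFeature k c φ ψ) (ν μ : Measure (E d)) [IsProbabilityMeasure ν]
    [IsProbabilityMeasure μ] : mmd k ν μ ≤ 2 * c := by
  have h : ∀ ρ : Measure (E d), IsProbabilityMeasure ρ → ‖∫ x, φ x ∂ρ‖ ≤ c := fun ρ _ => by
    simpa using norm_integral_le_of_norm_le_const (μ := ρ) (Eventually.of_forall hφ.norm_le)
  rw [hφ.mmd_eq]
  linarith [_root_.norm_sub_le (∫ x, φ x ∂ν) (∫ x, φ x ∂μ), h ν ‹_›, h μ ‹_›]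

theorem integral_grad (hφ : IsSmoothFeature k c φ ψ) (μ : Measure (E d)) [IsFiniteMeasure μ]
    (z : E d) (l : Fin d) : (∫ y, grad₁ k z y ∂μ) l = ⟪ψ l z, ∫ y, φ y ∂μ⟫ := by
  have hg : ∀ y l, grad₁ k z y l = ⟪ψ l z, φ y⟫ := fun y l => by
    simp [grad₁, hφ.partialFst_eq]
  rw [eval_integral_piLp fun l => by simpa only [hg] using (hφ.integrable μ).const_inner _]
  simp only [hg]
  exact integral_inner (hφ.integrable μ) _

/-- One step of the descent follows the gradient of the witness function. -/
theorem descentStep_apply (hφ : IsSmoothFeature k c φ ψ) (μ : Measure (E d)) [IsFiniteMeasure μ]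
    {n : ℕ} (γ β : ℝ) (x v : Fin n → E d) (i : Fin n) (l : Fin d) :
    descentStep k μ γ β x v i l = x i l - γ * ⟪ψ l (x i + β • v i),
      (n : ℝ)⁻¹ • ∑ j, φ (x j) - ∫ y, φ y ∂μ⟫ := by
  have := hφ.integral_grad μ (x i + β • v i) l
  simp [descentStep, this, inner_sub_right, inner_smul_right, inner_sum]
  simp [grad₁, hφ.partialFst_eq]

end IsSmoothFeature

/-! ### One step of the descent -/

namespace IsSmoothFeature

variable {d : ℕ} {H : Type*} [NormedAddCommGroup H] [InnerProductSpace ℝ H]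
  {k : E d → E d → ℝ} {c : ℝ} {φ : E d → H} {ψ : Fin d → E d → H}

/-- Norm of the displacement of a feature under a step along the witness gradient at `z`. -/
theorem norm_particle_sub_sq_le (hφ : IsSmoothFeature k c φ ψ) (γ : ℝ) (x w : E d) :
    ‖φ (x + γ • w) - φ x‖ ^ 2 ≤ c ^ 2 * γ ^ 2 * d * ∑ l, w l ^ 2 := by
  have h1 := hφ.norm_sub_le x (γ • w)
  have h2 : ∑ l, |(γ • w) l| = |γ| * ∑ l, |w l| := by
    simp [abs_mul, Finset.mul_sum]
  rw [h2] at h1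
  calc _ ≤ (c * (|γ| * ∑ l, |w l|)) ^ 2 := pow_le_pow_left₀ (norm_nonneg _) h1 2
    _ = c ^ 2 * γ ^ 2 * (∑ l, |w l|) ^ 2 := by rw [mul_pow, mul_pow, sq_abs]; ring
    _ ≤ c ^ 2 * γ ^ 2 * (d * ∑ l, w l ^ 2) :=
      mul_le_mul_of_nonneg_left (sq_sum_abs_le w.ofLp) (by positivity)
    _ = _ := by ring

/-- First variation along the witness `g` of one particle moving against the gradient of `g`
at the perturbed position `z`. -/
theorem inner_particle_sub_le (hφ : IsSmoothFeature k c φ ψ) {γ D : ℝ} (hγ : 0 ≤ γ) {g : H}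
    (hg : ‖g‖ ≤ 2 * c) {x z : E d} (hz : ∑ r, |z r - x r| ≤ D) {w : E d}
    (hw : ∀ l, w l = -⟪ψ l z, g⟫) :
    2 * ⟪g, φ (x + γ • w) - φ x⟫ ≤
      2 * γ * d * c ^ 2 * D * ‖g‖ ^ 2 + γ * (4 * (γ * d * c ^ 2) - 2) * ∑ l, w l ^ 2 := by
  have hc := hφ.nonneg
  set ρ := φ (x + γ • w) - φ x - ∑ l, (γ • w) l • ψ l x with hρ
  have h1 := hφ.norm_taylor_le x (γ • w)
  have h2 : ∑ l, |(γ • w) l| = γ * ∑ l, |w l| := by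
    simp [abs_mul, Finset.mul_sum, abs_of_nonneg hγ]
  rw [h2, ← hρ, mul_pow] at h1
  -- The crude bound on `‖g‖` makes the remainder a multiple of `γ ^ 2 * ∑ l, w l ^ 2`, which the
  -- descent term can absorb.
  have hρ' : ⟪g, ρ⟫ ≤ 2 * c * (c * (γ ^ 2 * (d * ∑ l, w l ^ 2))) :=
    calc ⟪g, ρ⟫ ≤ ‖g‖ * ‖ρ‖ := real_inner_le_norm _ _
      _ ≤ 2 * c * (c * (γ ^ 2 * (d * ∑ l, w l ^ 2))) := by
        refine mul_le_mul hg (h1.trans ?_) (norm_nonneg _) (by positivity)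
        have := sq_sum_abs_le w.ofLp
        gcongr
  -- With `ψ l z` in place of `ψ l x` the term is exactly `-γ * w l ^ 2`. The error has one factor
  -- `‖g‖` from `w l` and one from the inner product.
  have hlin : ∀ l, ⟪g, (γ • w) l • ψ l x⟫ ≤ γ * (c ^ 2 * D * ‖g‖ ^ 2) - γ * w l ^ 2 := fun l => by
    have hψ : ‖ψ l z - ψ l x‖ ≤ c * D := by
      have := hφ.norm_deriv_sub_le l x (z - x)
      rw [add_sub_cancel] at this
      exact this.trans (mul_le_mul_of_nonneg_left (by simpa using hz) hc)
    have hwl : |w l| ≤ c * ‖g‖ := by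
      rw [hw, abs_neg]
      exact (abs_real_inner_le_norm _ _).trans
        (mul_le_mul_of_nonneg_right (hφ.norm_deriv_le l z) (norm_nonneg _))
    have hin : |⟪ψ l z - ψ l x, g⟫| ≤ c * D * ‖g‖ :=
      (abs_real_inner_le_norm _ _).trans (mul_le_mul_of_nonneg_right hψ (norm_nonneg _))
    have e : ⟪g, (γ • w) l • ψ l x⟫ = γ * (-(w l * ⟪ψ l z - ψ l x, g⟫)) - γ * w l ^ 2 := by
      have : ⟪ψ l z, g⟫ = -w l := by rw [hw, neg_neg]
      rw [inner_smul_right, inner_sub_left, this, real_inner_comm]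
      simp only [PiLp.smul_apply, smul_eq_mul]
      ring
    rw [e]
    gcongr
    calc -(w l * ⟪ψ l z - ψ l x, g⟫) ≤ |w l| * |⟪ψ l z - ψ l x, g⟫| := by
          rw [← abs_mul]; exact neg_le_abs _
      _ ≤ (c * ‖g‖) * (c * D * ‖g‖) := mul_le_mul hwl hin (abs_nonneg _) (by positivity)
      _ = _ := by ring
  have hsum := Finset.sum_le_sum fun l (_ : l ∈ Finset.univ) => hlin l
  rw [Finset.sum_sub_distrib, Finset.sum_const, Finset.card_univ,
    Fintype.card_fin, nsmul_eq_mul, ← Finset.mul_sum] at hsum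
  have e : ⟪g, φ (x + γ • w) - φ x⟫ = ∑ l, ⟪g, (γ • w) l • ψ l x⟫ + ⟪g, ρ⟫ := by
    rw [← inner_sum, ← inner_add_right, hρ, add_sub_cancel]
  rw [e]
  linarith

variable [CompleteSpace H]

/-- One step of the noisy descent increases the squared discrepancy at most by a factor close to
one. -/
theorem mmd_descentStep_sq_le (hφ : IsSmoothFeature k c φ ψ) (μ : Measure (E d))
    [IsProbabilityMeasure μ] {n : ℕ} (hn : n ≠ 0) {γ β D : ℝ} (hγ : 0 ≤ γ)
    (hγc : 16 * (γ * d * c ^ 2) ≤ 1) (x v : Fin n → E d)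
    (hv : ∀ i, ∑ r, |β * v i r| ≤ D) :
    mmd k (empirical (descentStep k μ γ β x v)) μ ^ 2 ≤
      (1 + 2 * γ * d * c ^ 2 * D) * mmd k (empirical x) μ ^ 2 := by
  have hprob := isProbabilityMeasure_empirical hn x
  have hg2 := hφ.mmd_le (empirical x) μ
  rw [hφ.mmd_empirical μ hn] at hg2
  rw [hφ.mmd_empirical μ hn, hφ.mmd_empirical μ hn]
  set g := (n : ℝ)⁻¹ • ∑ i, φ (x i) - ∫ y, φ y ∂μ with hg
  set w : Fin n → E d := fun i => WithLp.toLp 2 fun l => -⟪ψ l (x i + β • v i), g⟫ with hw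
  have hx : ∀ i, descentStep k μ γ β x v i = x i + γ • w i := fun i => by
    ext l
    rw [hφ.descentStep_apply μ, ← hg]
    simp [hw, sub_eq_add_neg]
  simp only [hx]
  set δ : Fin n → H := fun i => φ (x i + γ • w i) - φ (x i) with hδ
  have hnpos : (0 : ℝ) < n := by exact_mod_cast Nat.pos_of_ne_zero hn
  have e : (n : ℝ)⁻¹ • ∑ i, φ (x i + γ • w i) - ∫ y, φ y ∂μ = g + (n : ℝ)⁻¹ • ∑ i, δ i := by
    simp only [hδ, hg, Finset.sum_sub_distrib, smul_sub]
    abel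
  have h1 : ∀ i, 2 * ⟪g, δ i⟫ ≤ 2 * γ * d * c ^ 2 * D * ‖g‖ ^ 2
      + γ * (4 * (γ * d * c ^ 2) - 2) * ∑ l, w i l ^ 2 := fun i =>
    hφ.inner_particle_sub_le hγ hg2 (z := x i + β • v i)
      (by simpa using hv i) fun l => rfl
  have h2 : ∀ i, ‖δ i‖ ^ 2 ≤ γ * (γ * d * c ^ 2) * ∑ l, w i l ^ 2 := fun i =>
    (hφ.norm_particle_sub_sq_le γ (x i) (w i)).trans_eq (by ring)
  -- The `5` is `4` from the Taylor remainder plus `1` from `‖δ i‖ ^ 2`; the smallness of `γ` makes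
  -- the coefficient negative.
  have h3 : ∀ i, 2 * ⟪g, δ i⟫ + ‖δ i‖ ^ 2 ≤ 2 * γ * d * c ^ 2 * D * ‖g‖ ^ 2 := fun i => by
    have hN : 0 ≤ γ * ∑ l, w i l ^ 2 := by positivity
    have : (5 * (γ * d * c ^ 2) - 2) * (γ * ∑ l, w i l ^ 2) ≤ 0 :=
      mul_nonpos_of_nonpos_of_nonneg (by linarith) hN
    linarith [h1 i, h2 i]
  have h4 : ‖∑ i, δ i‖ ^ 2 ≤ n * ∑ i, ‖δ i‖ ^ 2 :=
    (pow_le_pow_left₀ (norm_nonneg _) (norm_sum_le _ _) 2).trans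
      (by simpa using sq_sum_le_card_mul_sum_sq (s := Finset.univ) (f := fun i => ‖δ i‖))
  have h5 := Finset.sum_le_sum fun i (_ : i ∈ Finset.univ) => h3 i
  rw [Finset.sum_add_distrib, ← Finset.mul_sum, Finset.sum_const, Finset.card_univ,
    Fintype.card_fin, nsmul_eq_mul, ← inner_sum] at h5
  rw [e, norm_add_sq_real, norm_smul, inner_smul_right, mul_pow, Real.norm_eq_abs, sq_abs]
  have h6 : (n : ℝ)⁻¹ ^ 2 * ‖∑ i, δ i‖ ^ 2 ≤ (n : ℝ)⁻¹ * ∑ i, ‖δ i‖ ^ 2 := by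
    calc _ ≤ (n : ℝ)⁻¹ ^ 2 * (n * ∑ i, ‖δ i‖ ^ 2) := by gcongr
      _ = _ := by field_simp
  have h7 : (n : ℝ)⁻¹ * (2 * ⟪g, ∑ i, δ i⟫ + ∑ i, ‖δ i‖ ^ 2)
      ≤ 2 * γ * d * c ^ 2 * D * ‖g‖ ^ 2 := by
    rw [inv_mul_le_iff₀ hnpos]; exact h5
  linarith

end IsSmoothFeature

/-! ### The noise -/

/-- Gaussian tail bound, in a form uniform over all coordinates of the noise. -/
theorem exists_stdGaussian_tail (d : ℕ) :
    ∃ a > 0, ∃ D > 0, ∀ r : ℝ, 0 ≤ r →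
      (stdGaussian (E d)) {x | r < ‖x‖} ≤ ENNReal.ofReal (D * Real.exp (-(a * r ^ 2))) := by
  obtain ⟨a, ha, hint⟩ := IsGaussian.exists_integrable_exp_sq (stdGaussian (E d))
  have hnn : 0 ≤ ∫ x, Real.exp (a * ‖x‖ ^ 2) ∂(stdGaussian (E d)) :=
    integral_nonneg fun _ => (Real.exp_pos _).le
  refine ⟨a, ha, (∫ x, Real.exp (a * ‖x‖ ^ 2) ∂(stdGaussian (E d))) + 1, by linarith,
    fun r hr => ?_⟩
  have h := mul_meas_ge_le_integral_of_nonneg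
    (Eventually.of_forall fun x : E d => (Real.exp_pos (a * ‖x‖ ^ 2)).le) hint
    (Real.exp (a * r ^ 2))
  rw [← ofReal_measureReal]
  refine ENNReal.ofReal_le_ofReal ?_
  have hsub : (stdGaussian (E d)).real {x | r < ‖x‖} ≤
      (stdGaussian (E d)).real {x | Real.exp (a * r ^ 2) ≤ Real.exp (a * ‖x‖ ^ 2)} :=
    measureReal_mono fun x (hx : r < ‖x‖) => Real.exp_le_exp.2 (by gcongr)
  rw [Real.exp_neg, ← div_eq_mul_inv, le_div_iff₀ (Real.exp_pos _), mul_comm]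
  calc _ ≤ Real.exp (a * r ^ 2) *
        (stdGaussian (E d)).real {x | Real.exp (a * r ^ 2) ≤ Real.exp (a * ‖x‖ ^ 2)} := by gcongr
    _ ≤ _ := by linarith

/-- With probability at least `1 - e⁻ⁿ`, all noise vectors up to time `T ≤ B n` have norm at most
`K √n`. -/
theorem exists_noise_bound (d : ℕ) (B : ℝ) :
    ∃ K > 0, ∀ (n T : ℕ), 1 ≤ n → (T : ℝ) ≤ B * n →
      ∀ (Ω : Type*) (_ : MeasurableSpace Ω) (P : Measure Ω) (u : ℕ → Fin n → Ω → E d),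
        (∀ t i, HasLaw (u t i) (stdGaussian (E d)) P) →
        P (⋃ t ∈ Finset.range T, ⋃ i, {ω | K * √n < ‖u t i ω‖}) ≤
          ENNReal.ofReal (Real.exp (-n)) := by
  obtain ⟨a, ha, D, hD, htail⟩ := exists_stdGaussian_tail d
  -- In the exponent, `|B| * D` and two of the three units absorb the prefactors `|B| * D`, `n` and
  -- `n` of the union bound; the last unit leaves `exp (-n)`.
  set q := (3 + |B| * D) / a with hq
  have hqpos : 0 < q := by positivity
  refine ⟨√q, Real.sqrt_pos.2 hqpos, fun n T hn hT Ω _ P u hu => ?_⟩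
  have hn1 : (1 : ℝ) ≤ n := by exact_mod_cast hn
  have h1 : ∀ t i, P {ω | √q * √n < ‖u t i ω‖} ≤
      ENNReal.ofReal (D * Real.exp (-((3 + |B| * D) * n))) := fun t i => by
    have h := htail (√q * √n) (by positivity)
    rw [mul_pow, Real.sq_sqrt hqpos.le, Real.sq_sqrt (Nat.cast_nonneg n), ← mul_assoc, hq,
      mul_div_cancel₀ _ ha.ne'] at h
    rwa [(hu t i).measure_eq (p := fun x => √q * √n < ‖x‖)
      (measurableSet_lt measurable_const measurable_norm)]
  calc _ ≤ ∑ t ∈ Finset.range T, P (⋃ i, {ω | √q * √n < ‖u t i ω‖}) :=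
        measure_biUnion_finset_le _ _
    _ ≤ ∑ t ∈ Finset.range T, ∑ i : Fin n,
          ENNReal.ofReal (D * Real.exp (-((3 + |B| * D) * n))) :=
        Finset.sum_le_sum fun t _ => (measure_iUnion_fintype_le _ _).trans
          (Finset.sum_le_sum fun i _ => h1 t i)
    _ = ENNReal.ofReal (T * (n * (D * Real.exp (-((3 + |B| * D) * n))))) := by
        rw [Finset.sum_const, Finset.sum_const, Finset.card_univ, Fintype.card_fin,
          Finset.card_range, nsmul_eq_mul, nsmul_eq_mul,
          ENNReal.ofReal_mul (p := (T : ℝ)) (by positivity), ENNReal.ofReal_natCast,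
          ENNReal.ofReal_mul (p := (n : ℝ)) (by positivity), ENNReal.ofReal_natCast]
    _ ≤ _ := by
        refine ENNReal.ofReal_le_ofReal ?_
        have e1 : (n : ℝ) ≤ Real.exp n := by linarith [Real.add_one_le_exp (n : ℝ)]
        have e2 : |B| * D ≤ Real.exp (|B| * D * n) := by
          have := Real.add_one_le_exp (|B| * D * n)
          have : |B| * D * 1 ≤ |B| * D * n := by gcongr
          linarith
        have hT' : (T : ℝ) ≤ |B| * n := hT.trans (by gcongr; exact le_abs_self B)
        calc _ ≤ |B| * n * (n * (D * Real.exp (-((3 + |B| * D) * n)))) := by gcongr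
          _ = (|B| * D) * n * n * Real.exp (-((3 + |B| * D) * n)) := by ring
          _ ≤ Real.exp (|B| * D * n) * Real.exp n * Real.exp n
                * Real.exp (-((3 + |B| * D) * n)) := by gcongr
          _ = Real.exp (-n) := by
              rw [← Real.exp_add, ← Real.exp_add, ← Real.exp_add]; ring_nf

/-- This is `log x ≤ x ^ ε / ε` with `ε = 1 / (2 * b)`. It makes the number of steps `O(√n)`, the
reciprocal of the per-step growth. -/
theorem log_rpow_le_mul_sqrt {b : ℝ} (hb : 0 < b) {x : ℝ} (hx : 1 ≤ x) :
    Real.log x ^ b ≤ (2 * b) ^ b * √x := by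
  have h := Real.log_le_rpow_div (x := x) (by linarith) (ε := 1 / (2 * b)) (by positivity)
  calc Real.log x ^ b ≤ (x ^ (1 / (2 * b)) / (1 / (2 * b))) ^ b :=
        Real.rpow_le_rpow (Real.log_nonneg hx) h hb.le
    _ = (2 * b * x ^ (1 / (2 * b))) ^ b := by congr 1; field_simp
    _ = (2 * b) ^ b * √x := by
        rw [Real.mul_rpow (by positivity) (by positivity), ← Real.rpow_mul (by linarith),
          Real.sqrt_eq_rpow]
        congr 2
        field_simp

/-- Along a path of the noise on which all noise vectors have norm at most `R`, the squared
discrepancy grows at most geometrically, with a factor close to one. -/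
theorem mmd_sq_le_of_noise_le {d : ℕ} {κ : ℝ} {k : E d → E d → ℝ} {μ : Measure (E d)}
    [IsProbabilityMeasure μ] (hk : IsKernel k) (hI : IntegrableDifferentiable k μ)
    (hR : KernelRegularity k κ) {n T : ℕ} (hn : n ≠ 0) {γ R : ℝ} {β : ℕ → ℝ} (hγ : 0 < γ)
    (hγκ : 256 * γ ^ 2 * (d : ℝ) ^ 2 * κ ^ 2 ≤ 1)
    (hβ : ∀ t, 1 ≤ t → t < T → 0 < β t ∧ β t < 1 ∧ γ * β t = (n : ℝ)⁻¹)
    {x₁ : Fin n → E d} {Ω : Type*} {u : ℕ → Fin n → Ω → E d} {X : ℕ → Ω → Fin n → E d}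
    (hX : IsNoisyDescent k μ γ β x₁ u X) {ω : Ω} (hu : ∀ t < T, ∀ i, ‖u t i ω‖ ≤ R) :
    ∀ t, 1 ≤ t → t ≤ T → mmd k (empirical (X t ω)) μ ^ 2 ≤
      (1 + 2 * d * √d * κ * R * (n : ℝ)⁻¹) ^ t * mmd k (empirical x₁) μ ^ 2 := by
  obtain ⟨H, _, _, _, φ, ψ, hφ⟩ := exists_smoothFeature hk hI hR
  have hκ : 0 ≤ κ := (abs_nonneg _).trans (hR.bound 0)
  have hγ' : 16 * (γ * d * √κ ^ 2) ≤ 1 := by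
    rw [Real.sq_sqrt hκ]
    -- The step-size hypothesis is the square of this inequality.
    refine (sq_le_one_iff₀ (by positivity)).1 (le_trans (le_of_eq ?_) hγκ)
    ring
  set a := 2 * d * √d * κ * R * (n : ℝ)⁻¹ with ha
  intro t ht
  induction t, ht using Nat.le_induction with
  | base =>
    intro hT
    -- The exponent is `t`, one more than the number of steps taken, so the base case needs `a ≥ 0`;
    -- the sign of `R` is read off a noise vector at time `0`.
    have hR0 : 0 ≤ R := by
      obtain ⟨i⟩ : Nonempty (Fin n) := ⟨⟨0, Nat.pos_of_ne_zero hn⟩⟩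
      exact (norm_nonneg _).trans (hu 0 hT i)
    have ha0 : 0 ≤ a := by positivity
    rw [hX.init]
    exact le_mul_of_one_le_left (sq_nonneg _) (by simpa using ha0)
  | succ t ht ih =>
    intro hT
    have hR0 : 0 ≤ R := by
      obtain ⟨i⟩ : Nonempty (Fin n) := ⟨⟨0, Nat.pos_of_ne_zero hn⟩⟩
      exact (norm_nonneg _).trans (hu t hT i)
    have ha0 : 0 ≤ a := by positivity
    obtain ⟨hβ0, -, hγβ⟩ := hβ t ht hT
    have hstep : X (t + 1) ω = descentStep k μ γ (β t) (X t ω) fun j => u t j ω :=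
      funext fun i => hX.step t ht ω i
    have hD : ∀ i, ∑ r, |β t * u t i ω r| ≤ β t * (√d * R) := fun i => by
      simp only [abs_mul, abs_of_pos hβ0, ← Finset.mul_sum]
      gcongr
      exact (sum_abs_le_sqrt_mul_norm _).trans (by gcongr; exact hu t hT i)
    have h := hφ.mmd_descentStep_sq_le μ hn hγ.le hγ' (X t ω) (fun j => u t j ω) hD
    have e : 2 * γ * d * √κ ^ 2 * (β t * (√d * R)) = a := by
      rw [Real.sq_sqrt hκ, ha, ← hγβ]; ring
    rw [e] at h
    rw [hstep]
    calc _ ≤ (1 + a) * mmd k (empirical (X t ω)) μ ^ 2 := h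
      _ ≤ (1 + a) * ((1 + a) ^ t * mmd k (empirical x₁) μ ^ 2) := by
          gcongr
          exact ih (by lia)
      _ = _ := by ring

theorem mmd_empirical_le {d : ℕ} {κ : ℝ} {k : E d → E d → ℝ} {μ : Measure (E d)}
    [IsProbabilityMeasure μ] (hk : IsKernel k) (hI : IntegrableDifferentiable k μ)
    (hR : KernelRegularity k κ) {n : ℕ} (hn : n ≠ 0) (x : Fin n → E d) :
    mmd k (empirical x) μ ≤ 2 * √κ := by
  obtain ⟨H, _, _, _, φ, ψ, hφ⟩ := exists_smoothFeature hk hI hR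
  have := isProbabilityMeasure_empirical hn x
  exact hφ.mmd_le _ _

end MMDFlow

/-!
### The main theorem

On the event that all noise vectors have norm `O(√n)`, the identity `γ β = 1 / n` bounds the growth
of the squared discrepancy in one step by a factor `1 + O(1 / √n)`, and there are
`T = O((log n) ^ b) = O(√n)` steps. This needs neither the noise injection level condition nor the
independence of the noise. For `δ > n` the bound follows from the boundedness of the kernel.
-/

theorem mainTheorem6 (d : ℕ) (κ b A B : ℝ) (hb : 0 < b) :
    ∃ C : ℝ, 0 < C ∧
      ∀ (k : MMDFlow.E d → MMDFlow.E d → ℝ) (μ : Measure (MMDFlow.E d)),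
        IsProbabilityMeasure μ → MMDFlow.IsKernel k →
        MMDFlow.IntegrableDifferentiable k μ → MMDFlow.KernelRegularity k κ →
      ∀ (n : ℕ), 2 ≤ n →
      ∀ (T : ℕ), 1 ≤ T → (T : ℝ) ≤ B * (Real.log n) ^ b →
      ∀ (γ : ℝ) (β : ℕ → ℝ), 0 < γ → 256 * γ ^ 2 * (d : ℝ) ^ 2 * κ ^ 2 ≤ 1 →
        (∀ t, 1 ≤ t → t < T → 0 < β t ∧ β t < 1 ∧ γ * β t = (n : ℝ)⁻¹) →
      ∀ (x₁ : Fin n → MMDFlow.E d),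
        MMDFlow.mmd k (MMDFlow.empirical x₁) μ ≤ A * ((n : ℝ)⁻¹ * (Real.log n) ^ b) →
      ∀ (Ω : Type*) (_ : MeasurableSpace Ω) (P : Measure Ω), IsProbabilityMeasure P →
      ∀ (u : ℕ → Fin n → Ω → MMDFlow.E d) (X : ℕ → Ω → Fin n → MMDFlow.E d),
        (∀ t i, HasLaw (u t i) (stdGaussian (MMDFlow.E d)) P) →
        iIndepFun (fun p : ℕ × Fin n => u p.1 p.2) P →
        MMDFlow.IsNoisyDescent k μ γ β x₁ u X →
        (∀ t, 1 ≤ t → t < T → ∀ᵐ ω ∂P, MMDFlow.NoiseCondition k μ κ (β t) (X t ω)) →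
      ∀ δ : ℝ, 0 < δ →
        ENNReal.ofReal (1 - Real.exp (-δ)) ≤
          P {ω | MMDFlow.mmd k (MMDFlow.empirical (X T ω)) μ ≤
            C * (1 + δ) * ((n : ℝ)⁻¹ * (Real.log n) ^ b)} := by
  obtain ⟨K, hK, hnoise⟩ := MMDFlow.exists_noise_bound d (|B| * (2 * b) ^ b)
  -- `L` will bound `T` times the per-step excess. The absolute value is there because `κ ≥ 0`
  -- follows only once a kernel is given.
  set L := 2 * d * √d * |κ| * K * (|B| * (2 * b) ^ b) with hL
  have hL0 : 0 ≤ L := by positivity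
  have hlog2 : 0 < Real.log 2 := Real.log_pos one_lt_two
  -- The first summand serves `δ ≤ n`, the second `δ > n`, where `log n ≥ log 2`; the `1` makes the
  -- constant positive.
  refine ⟨Real.exp L * |A| + 2 * √κ / (Real.log 2) ^ b + 1, by positivity, ?_⟩
  intro k μ hμ hk hI hR n hn T hT1 hT γ β hγ hγκ hβ x₁ hx₁ Ω _ P hP u X hu _ hX _ δ hδ
  set C := Real.exp L * |A| + 2 * √κ / (Real.log 2) ^ b + 1 with hC
  have hκ : 0 ≤ κ := (abs_nonneg _).trans (hR.bound 0)
  have hn0 : n ≠ 0 := by lia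
  have hn2 : (2 : ℝ) ≤ n := by exact_mod_cast hn
  have hnpos : (0 : ℝ) < n := by linarith
  have hlogn : (Real.log 2) ^ b ≤ (Real.log n) ^ b :=
    Real.rpow_le_rpow hlog2.le (Real.log_le_log two_pos hn2) hb.le
  have hlogn0 : 0 < (Real.log n) ^ b := (by positivity : 0 < (Real.log 2) ^ b).trans_le hlogn
  set r := (n : ℝ)⁻¹ * (Real.log n) ^ b with hr
  have hr0 : 0 < r := by positivity
  rcases lt_or_ge (n : ℝ) δ with hδn | hδn
  · have huniv : {ω | MMDFlow.mmd k (MMDFlow.empirical (X T ω)) μ ≤ C * (1 + δ) * r} = univ := by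
      refine eq_univ_of_forall fun ω => (MMDFlow.mmd_empirical_le hk hI hR hn0 _).trans ?_
      have h1 : (1 : ℝ) ≤ (1 + δ) * (n : ℝ)⁻¹ := by
        rw [← div_eq_mul_inv, one_le_div hnpos]; linarith
      calc 2 * √κ = 2 * √κ / (Real.log 2) ^ b * (Real.log 2) ^ b * 1 := by field_simp
        _ ≤ C * (Real.log n) ^ b * ((1 + δ) * (n : ℝ)⁻¹) := by
            gcongr
            rw [hC]
            have : 0 ≤ Real.exp L * |A| := by positivity
            linarith
        _ = _ := by rw [hr]; ring
    rw [huniv, measure_univ, ← ENNReal.ofReal_one]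
    exact ENNReal.ofReal_le_ofReal (by linarith [Real.exp_pos (-δ)])
  have hTs : (T : ℝ) ≤ |B| * (2 * b) ^ b * √n :=
    calc (T : ℝ) ≤ |B| * (Real.log n) ^ b := hT.trans (by gcongr; exact le_abs_self B)
      _ ≤ |B| * ((2 * b) ^ b * √n) := by
          gcongr
          exact MMDFlow.log_rpow_le_mul_sqrt hb (by linarith)
      _ = _ := by ring
  have hsq : √(n : ℝ) * √n = n := Real.mul_self_sqrt hnpos.le
  have hsqrt : 1 ≤ √(n : ℝ) := Real.one_le_sqrt.2 (by linarith)
  have hTn : (T : ℝ) ≤ |B| * (2 * b) ^ b * n :=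
    hTs.trans (by gcongr; nlinarith)
  have hbad := hnoise n T (by lia) hTn Ω _ P u hu
  set bad := ⋃ t ∈ Finset.range T, ⋃ i, {ω | K * √n < ‖u t i ω‖} with hbad_def
  -- Covering the space and using subadditivity avoids measurability of the good event.
  have hcover : univ ⊆
      {ω | MMDFlow.mmd k (MMDFlow.empirical (X T ω)) μ ≤ C * (1 + δ) * r} ∪ bad := by
    intro ω _
    by_cases hω : ω ∈ bad
    · exact Or.inr hω
    refine Or.inl ?_
    have hu' : ∀ t < T, ∀ i, ‖u t i ω‖ ≤ K * √n := by
      simpa [hbad_def] using hω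
    have h := MMDFlow.mmd_sq_le_of_noise_le hk hI hR hn0 hγ hγκ hβ hX hu' T hT1 le_rfl
    set a := 2 * d * √d * κ * (K * √n) * (n : ℝ)⁻¹ with ha
    have ha0 : 0 ≤ a := by positivity
    -- `exp L` would already do; the square lets the root be taken at once.
    have hfac : (1 + a) ^ T ≤ Real.exp L ^ 2 := by
      have e1 : (1 + a) ^ T ≤ Real.exp a ^ T :=
        pow_le_pow_left₀ (by positivity) (by linarith [Real.add_one_le_exp a]) T
      refine e1.trans ?_
      rw [← Real.exp_nat_mul, ← Real.exp_nat_mul, Real.exp_le_exp]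
      have e2 : T * a ≤ L :=
        calc T * a ≤ |B| * (2 * b) ^ b * √n * a := by gcongr
          _ = |B| * (2 * b) ^ b * (2 * d * √d * κ * K) * ((√n * √n) * (n : ℝ)⁻¹) := by
              rw [ha]; ring
          _ = L := by rw [hsq, mul_inv_cancel₀ hnpos.ne', hL, abs_of_nonneg hκ]; ring
      push_cast
      linarith
    have hm0 : 0 ≤ MMDFlow.mmd k (MMDFlow.empirical x₁) μ := Real.sqrt_nonneg _
    have hmT : MMDFlow.mmd k (MMDFlow.empirical (X T ω)) μ ≤
        Real.exp L * MMDFlow.mmd k (MMDFlow.empirical x₁) μ := by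
      refine le_of_sq_le_sq ?_ (by positivity)
      rw [mul_pow]
      exact h.trans (by gcongr)
    calc MMDFlow.mmd k (MMDFlow.empirical (X T ω)) μ
        ≤ Real.exp L * (|A| * r) := hmT.trans (by
          gcongr
          exact hx₁.trans (by gcongr; exact le_abs_self A))
      _ ≤ C * (1 + δ) * r := by
          rw [← mul_assoc]
          refine mul_le_mul_of_nonneg_right ?_ hr0.le
          have h1 : 0 ≤ 2 * √κ / (Real.log 2) ^ b := by positivity
          have h2 : 0 ≤ Real.exp L * |A| := by positivity
          nlinarith
  have hone : 1 ≤ P {ω | MMDFlow.mmd k (MMDFlow.empirical (X T ω)) μ ≤ C * (1 + δ) * r} +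
      ENNReal.ofReal (Real.exp (-δ)) :=
    calc 1 = P univ := measure_univ.symm
      _ ≤ _ := measure_mono hcover
      _ ≤ _ := measure_union_le _ _
      _ ≤ _ := by
          gcongr
          exact hbad.trans (ENNReal.ofReal_le_ofReal (Real.exp_le_exp.2 (by linarith)))
  rw [ENNReal.ofReal_sub _ (Real.exp_pos _).le, ENNReal.ofReal_one, tsub_le_iff_right]
  exact hone
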